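/- Let ${}^{*}$ be an $\aleph_1$-saturated nonstandard model: an interpretation of all relations and operations on the hierarchy of finite types over $\mathbb{R}$ (reals, sets of reals, sets of sets of reals, $\dots$) which satisfies exactly the same first-order sentences as the standard hierarchy, and in which every countable family of internal sets with the finite intersection property has nonempty intersection. Let $k\in{}^{*}\mathbb{N}$ be infinite, let $K=\{x\in{}^{*}\mathbb{N}:0\le x<k\}$, and let $\mathfrak{K}$ be the algebra of all internal subsets of $K$, with the normalised counting measure $\nu(A)=\mathrm{Card}(A)/k\in{}^{*}\mathbb{R}$, where $\mathrm{Card}$ is the internal cardinality. Let $P$ be the Loeb measure of $\nu$, that is, the measure induced by the outer measure $E\mapsto\inf\{\sum_n{}^{\circ}\nu(A_n): E\subseteq\bigcup_{n\in\mathbb{N}} A_n,\ A_n\in\mathfrak{K}\}$ on the $\sigma$-algebra generated by $\mathfrak{K}$, and then on the completion $\mathfrak{B}$ of that $\sigma$-algebra; here ${}^{\circ}$ denotes the standard part. Let $\phi:K\to K$ be the rotation $\phi(x)=x+1$ if $0\le x<k-1$, and $\phi(k-1)=0$. Then $(K,\mathfrak{B},P)$ is a probability space with $P(A)={}^{\circ}\nu(A)$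 for every $A\in\mathfrak{K}$, the map $\phi$ is a measure preserving transformation of it, and the ergodic theorem holds for $(K,\mathfrak{B},P,\phi)$: for every real-valued $g\in L^{1}(K,\mathfrak{B},P)$, the limit $$\diamond g(x)=\lim_{n\to\infty}\frac1n\sum_{i=0}^{n-1}g(\phi^{i}x)$$ exists (as a real number) for $P$-almost all $x\in K$, and $\diamond g\in L^{1}(K,\mathfrak{B},P)$, with $$\int_K\diamond g\,dP=\int_K g\,dP .$$ -/

import Mathlib

open Filter Topology MeasureTheory
open scoped ENNReal

namespace NSA

/-! ## The standard universe: the full hierarchy of finite types over the real numbers -/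

/-- Level `0` consists of the real numbers, level `n + 1` of all sets of objects of level `n`. -/
def Level : ℕ → Type
  | 0 => ℝ
  | n + 1 => Set (Level n)

/-- A standard object: a real number, a set of reals, a set of sets of reals, and so on. -/
def Obj : Type := Σ n, Level n

namespace Obj

/-- A real number as a standard object. -/
def real (r : ℝ) : Obj := ⟨0, r⟩

/-- A set of objects of level `n` as an object of level `n + 1`. -/
def set {n : ℕ} (A : Set (Level n)) : Obj := ⟨n + 1, A⟩

/-- The membership relation. -/
def Mem (a b : Obj) : Prop :=
  ∃ (n : ℕ) (x : Level n) (A : Set (Level n)), a = ⟨n, x⟩ ∧ b = set A ∧ x ∈ A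

/-- Being a set of objects of level `n`. -/
def IsSetOfLevel (n : ℕ) (a : Obj) : Prop := ∃ A : Set (Level n), a = set A

/-- Being a natural number. -/
def IsNat (a : Obj) : Prop := ∃ n : ℕ, a = real n

/-- The strict order of the real numbers. -/
def Lt (a b : Obj) : Prop := ∃ x y : ℝ, a = real x ∧ b = real y ∧ x < y

/-- The order of the real numbers. -/
def Le (a b : Obj) : Prop := ∃ x y : ℝ, a = real x ∧ b = real y ∧ x ≤ y

/-- A binary operation on the reals as an operation on objects, with value `0` whenever one of the
arguments is not a real number. -/
def realOp (f : ℝ → ℝ → ℝ) : Obj → Obj → Obj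
  | ⟨0, x⟩, ⟨0, y⟩ => real (f x y)
  | _, _ => real 0

/-- Addition of reals. -/
def add : Obj → Obj → Obj := realOp fun x y => x + y

/-- Subtraction of reals. -/
def sub : Obj → Obj → Obj := realOp fun x y => x - y

/-- Division of reals. -/
noncomputable def div : Obj → Obj → Obj := realOp fun x y => x / y

/-- The set of those elements of the set `a` that satisfy `p` (with value `a` if `a` is a real). -/
def sep (p : Obj → Prop) : Obj → Obj
  | ⟨0, x⟩ => ⟨0, x⟩
  | ⟨n + 1, A⟩ => set {x : Level n | x ∈ (show Set (Level n) from A) ∧ p ⟨n, x⟩}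

/-- Intersection of sets. -/
def inter (a b : Obj) : Obj := sep (fun x => Mem x b) a

/-- Difference of sets. -/
def diff (a b : Obj) : Obj := sep (fun x => ¬ Mem x b) a

/-- The number of elements of a finite set (with value `0` at infinite sets and at reals). -/
noncomputable def card : Obj → Obj
  | ⟨0, _⟩ => real 0
  | ⟨_ + 1, A⟩ => real (Set.ncard A : ℕ)

end Obj

/-! ## Nonstandard models -/

/-- The language with a symbol for every finitary relation and for every finitary operation
(in particular for every element) of the standard universe. -/
def fullLanguage : FirstOrder.Language where
  Functions n := (Fin n → Obj) → Obj
  Relations n := (Fin n → Obj) → Prop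

/-- The symbol for an operation. -/
def funSym {n : ℕ} (f : (Fin n → Obj) → Obj) : fullLanguage.Functions n := f

/-- The symbol for a relation. -/
def relSym {n : ℕ} (R : (Fin n → Obj) → Prop) : fullLanguage.Relations n := R

/-- In the standard universe every symbol denotes itself. -/
instance : fullLanguage.Structure Obj where
  funMap f v := f v
  RelMap R v := R v

/-- A nonstandard model: an interpretation of all the symbols in which exactly the same first-order
sentences hold as in the standard universe (the transfer principle). -/
class NonstandardModel (M : Type*) extends fullLanguage.Structure M where
  transfer : fullLanguage.ElementarilyEquivalent Obj M

section Model

variable {M : Type*} [NonstandardModel M]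

/-- The element `*a` of the model that corresponds to the standard object `a`. -/
def star (a : Obj) : M :=
  FirstOrder.Language.Structure.funMap (funSym (n := 0) fun _ => a) ![]

/-- The extension `*f` of a unary operation `f`. -/
def starFun₁ (f : Obj → Obj) (x : M) : M :=
  FirstOrder.Language.Structure.funMap (funSym (n := 1) fun v => f (v 0)) ![x]

/-- The extension `*f` of a binary operation `f`. -/
def starFun₂ (f : Obj → Obj → Obj) (x y : M) : M :=
  FirstOrder.Language.Structure.funMap (funSym (n := 2) fun v => f (v 0) (v 1)) ![x, y]

/-- The extension `*R` of a unary relation `R`. -/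
def starRel₁ (R : Obj → Prop) (x : M) : Prop :=
  FirstOrder.Language.Structure.RelMap (relSym (n := 1) fun v => R (v 0)) ![x]

/-- The extension `*R` of a binary relation `R`. -/
def starRel₂ (R : Obj → Obj → Prop) (x y : M) : Prop :=
  FirstOrder.Language.Structure.RelMap (relSym (n := 2) fun v => R (v 0) (v 1)) ![x, y]

/-- `x` is a hypernatural number. -/
def IsHypernat (x : M) : Prop := starRel₁ Obj.IsNat x

/-- The strict order of the hyperreals. -/
def HLt (x y : M) : Prop := starRel₂ Obj.Lt x y

/-- The order of the hyperreals. -/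
def HLe (x y : M) : Prop := starRel₂ Obj.Le x y

/-- `a` is an element of the model that stands for an internal set, that is `a` belongs to the
extension of the collection of all sets of objects of level `n`, for some standard `n`. -/
def IsInternalCode (a : M) : Prop := ∃ n : ℕ, starRel₁ (Obj.IsSetOfLevel n) a

/-- The set of all elements `x` of the model with `x *∈ a`. -/
def ext (a : M) : Set M := {x | starRel₂ Obj.Mem x a}

/-- `B` is an internal set. -/
def IsInternal (B : Set M) : Prop := ∃ a : M, IsInternalCode a ∧ ext a = B

/-- The standard part of a finite hyperreal. -/
noncomputable def st (x : M) : ℝ := sSup {r : ℝ | HLe (star (Obj.real r)) x}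

variable (M) in
/-- The hypernatural numbers. -/
structure Hypernat where
  /-- the underlying element of the model -/
  val : M
  isHypernat : IsHypernat val

/-- `k` exceeds all standard natural numbers. -/
def Hypernat.IsInfinite (k : Hypernat M) : Prop := ∀ n : ℕ, HLt (star (Obj.real n)) k.val

variable (M) in
/-- `ℵ₁`-saturation: every countable family of internal sets with the finite intersection property
has nonempty intersection. -/
def IsAlephOneSaturated : Prop :=
  ∀ B : ℕ → Set M, (∀ n, IsInternal (B n)) →
    (∀ s : Finset ℕ, (⋂ n ∈ s, B n).Nonempty) → (⋂ n, B n).Nonempty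

/-! ### Helper facts obtained by transfer -/

section Transfer

open FirstOrder FirstOrder.Language

theorem transfer_forall {n : ℕ} (F : fullLanguage.Formula (Fin n))
    (h : ∀ v : Fin n → Obj, F.Realize v) (w : Fin n → M) : F.Realize w := by
  let G : fullLanguage.Sentence :=
    Formula.iAlls (α := Empty) (Fin n) (F.relabel (Sum.inr : Fin n → Empty ⊕ Fin n))
  have hG : ∀ (N : Type _) [fullLanguage.Structure N],
      N ⊨ G ↔ ∀ v : Fin n → N, F.Realize v := by
    intro N _
    simp only [G, Sentence.Realize, Formula.realize_iAlls, Formula.realize_relabel]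
    rfl
  have h1 : Obj ⊨ G := by
    simp only [G, Sentence.Realize, Formula.realize_iAlls, Formula.realize_relabel]
    exact fun v => h v
  have h2 : M ⊨ G := (elementarilyEquivalent_iff.1 NonstandardModel.transfer G).1 h1
  exact (hG M).1 h2 w

/-- The term given by a constant. -/
def tc {n : ℕ} (a : Obj) : fullLanguage.Term (Fin n) :=
  Term.func (funSym (n := 0) fun _ => a) ![]

/-- The term given by a unary operation. -/
def t1 {n : ℕ} (f : Obj → Obj) (s : fullLanguage.Term (Fin n)) : fullLanguage.Term (Fin n) :=
  Term.func (funSym (n := 1) fun v => f (v 0)) ![s]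

/-- The term given by a binary operation. -/
def t2 {n : ℕ} (f : Obj → Obj → Obj) (s t : fullLanguage.Term (Fin n)) :
    fullLanguage.Term (Fin n) :=
  Term.func (funSym (n := 2) fun v => f (v 0) (v 1)) ![s, t]

/-- The atomic formula given by a unary relation. -/
def f1 {n : ℕ} (R : Obj → Prop) (s : fullLanguage.Term (Fin n)) : fullLanguage.Formula (Fin n) :=
  Relations.formula (relSym (n := 1) fun v => R (v 0)) ![s]

/-- The atomic formula given by a binary relation. -/
def f2 {n : ℕ} (R : Obj → Obj → Prop) (s t : fullLanguage.Term (Fin n)) :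
    fullLanguage.Formula (Fin n) :=
  Relations.formula (relSym (n := 2) fun v => R (v 0) (v 1)) ![s, t]

@[simp] theorem realize_tc {n : ℕ} (a : Obj) (w : Fin n → M) : (tc a).realize w = star a := by
  unfold tc star
  rw [Term.realize_func]
  congr 1
  funext i
  exact i.elim0

@[simp] theorem realize_t1 {n : ℕ} (f : Obj → Obj) (s) (w : Fin n → M) :
    (t1 f s).realize w = starFun₁ f (s.realize w) := by
  unfold t1 starFun₁
  rw [Term.realize_func]
  congr 1
  funext i
  fin_cases i
  rfl

@[simp] theorem realize_t2 {n : ℕ} (f : Obj → Obj → Obj) (s t) (w : Fin n → M) :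
    (t2 f s t).realize w = starFun₂ f (s.realize w) (t.realize w) := by
  unfold t2 starFun₂
  rw [Term.realize_func]
  congr 1
  funext i
  fin_cases i <;> rfl

@[simp] theorem realize_f1 {n : ℕ} (R : Obj → Prop) (s) (w : Fin n → M) :
    (f1 R s).Realize w ↔ starRel₁ R (s.realize w) := by
  unfold f1 starRel₁
  rw [Formula.realize_rel]
  have : (fun i => (![s] i).realize w) = ![s.realize w] := by
    funext i
    fin_cases i
    rfl
  rw [this]

@[simp] theorem realize_f2 {n : ℕ} (R : Obj → Obj → Prop) (s t) (w : Fin n → M) :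
    (f2 R s t).Realize w ↔ starRel₂ R (s.realize w) (t.realize w) := by
  unfold f2 starRel₂
  rw [Formula.realize_rel]
  have : (fun i => (![s, t] i).realize w) = ![s.realize w, t.realize w] := by
    funext i
    fin_cases i <;> rfl
  rw [this]

/-- The standard universe trivially satisfies the transfer principle (but is not saturated). -/
instance : NonstandardModel Obj where
  transfer := rfl

@[simp] theorem std_star (a : Obj) : (star a : Obj) = a := rfl
@[simp] theorem std_fun₁ (f : Obj → Obj) (x : Obj) : starFun₁ f x = f x := rfl
@[simp] theorem std_fun₂ (f : Obj → Obj → Obj) (x y : Obj) : starFun₂ f x y = f x y := rfl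
@[simp] theorem std_rel₁ (R : Obj → Prop) (x : Obj) : starRel₁ R x ↔ R x := Iff.rfl
@[simp] theorem std_rel₂ (R : Obj → Obj → Prop) (x y : Obj) : starRel₂ R x y ↔ R x y := Iff.rfl

theorem lt_real {x y : ℝ} : Obj.Lt (Obj.real x) (Obj.real y) ↔ x < y := by
  constructor
  · rintro ⟨a, b, ha, hb, hab⟩
    cases ha
    cases hb
    exact hab
  · exact fun h => ⟨x, y, rfl, rfl, h⟩

theorem le_real {x y : ℝ} : Obj.Le (Obj.real x) (Obj.real y) ↔ x ≤ y := by
  constructor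
  · rintro ⟨a, b, ha, hb, hab⟩
    cases ha
    cases hb
    exact hab
  · exact fun h => ⟨x, y, rfl, rfl, h⟩

theorem mem_set {n : ℕ} {x : Level n} {A : Set (Level n)} :
    Obj.Mem ⟨n, x⟩ (Obj.set A) ↔ x ∈ A := by
  constructor
  · rintro ⟨m, y, B, h1, h2, h3⟩
    cases h1
    cases h2
    exact h3
  · exact fun h => ⟨n, x, A, rfl, rfl, h⟩

theorem mem_sep {p : Obj → Prop} {x t : Obj} :
    Obj.Mem x (Obj.sep p t) ↔ Obj.Mem x t ∧ p x := by
  obtain ⟨n, t⟩ := t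
  cases n with
  | zero =>
    have h : ∀ y : ℝ, ¬ Obj.Mem x ⟨0, y⟩ := by
      rintro y ⟨m, z, B, -, h2, -⟩
      cases h2
    constructor
    · exact fun hx => (h t hx).elim
    · exact fun hx => (h t hx.1).elim
  | succ n =>
    constructor
    · rintro ⟨m, z, B, rfl, h2, h3⟩
      cases h2
      exact ⟨mem_set.2 h3.1, h3.2⟩
    · rintro ⟨⟨m, z, B, rfl, h2, h3⟩, h4⟩
      cases h2
      exact mem_set.2 ⟨h3, h4⟩

theorem succ_mem {x k : M} (hx : IsHypernat x)
    (h : HLt x (starFun₂ Obj.sub k (star (Obj.real 1)))) :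
    IsHypernat (starFun₂ Obj.add x (star (Obj.real 1))) ∧
      HLt (starFun₂ Obj.add x (star (Obj.real 1))) k := by
  have key := transfer_forall (M := M) (n := 2)
    ((f1 Obj.IsNat (.var 0) ⊓ f2 Obj.Lt (.var 0) (t2 Obj.sub (.var 1) (tc (Obj.real 1)))).imp
      (f1 Obj.IsNat (t2 Obj.add (.var 0) (tc (Obj.real 1))) ⊓
        f2 Obj.Lt (t2 Obj.add (.var 0) (tc (Obj.real 1))) (.var 1))) ?_ ![x, k]
  · simp only [Formula.realize_imp, Formula.realize_inf, realize_f1, realize_f2, realize_t2,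
      realize_tc, Term.realize_var] at key
    exact key ⟨hx, h⟩
  · intro v
    simp only [Formula.realize_imp, Formula.realize_inf, realize_f1, realize_f2, realize_t2,
      realize_tc, Term.realize_var, std_star, std_fun₂, std_rel₁, std_rel₂]
    generalize v 0 = x
    generalize v 1 = k
    rintro ⟨⟨n, rfl⟩, h⟩
    obtain ⟨m, y⟩ := k
    cases m with
    | zero =>
      change ℝ at y
      have h' : (n : ℝ) < y - 1 := lt_real.1 h
      exact ⟨⟨n + 1, by push_cast; rfl⟩, lt_real.2 (show (n : ℝ) + 1 < y by linarith)⟩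
    | succ m =>
      have h' : (n : ℝ) < 0 := lt_real.1 h
      exact absurd h' (not_lt.2 n.cast_nonneg)

theorem zero_mem {x k : M} (hx : IsHypernat x) (h : HLt x k) :
    IsHypernat (star (Obj.real 0) : M) ∧ HLt (star (Obj.real 0)) k := by
  have key := transfer_forall (M := M) (n := 2)
    ((f1 Obj.IsNat (.var 0) ⊓ f2 Obj.Lt (.var 0) (.var 1)).imp
      (f1 Obj.IsNat (tc (Obj.real 0)) ⊓ f2 Obj.Lt (tc (Obj.real 0)) (.var 1))) ?_ ![x, k]
  · simp only [Formula.realize_imp, Formula.realize_inf, realize_f1, realize_f2,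
      realize_tc, Term.realize_var] at key
    exact key ⟨hx, h⟩
  · intro v
    simp only [Formula.realize_imp, Formula.realize_inf, realize_f1, realize_f2,
      realize_tc, Term.realize_var, std_star, std_rel₁, std_rel₂]
    generalize v 0 = x
    generalize v 1 = k
    rintro ⟨⟨n, rfl⟩, ⟨a, b, ha, rfl, hab⟩⟩
    cases ha
    exact ⟨⟨0, by simp⟩, lt_real.2 (lt_of_le_of_lt n.cast_nonneg hab)⟩

theorem ext_inter (t a : M) : ext (starFun₂ Obj.inter t a) = ext t ∩ ext a := by
  ext x
  have key := transfer_forall (M := M) (n := 3)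
    ((f2 Obj.Mem (.var 0) (t2 Obj.inter (.var 1) (.var 2))).iff
      (f2 Obj.Mem (.var 0) (.var 1) ⊓ f2 Obj.Mem (.var 0) (.var 2))) ?_ ![x, t, a]
  · simp only [Formula.realize_iff, Formula.realize_inf, realize_f2, realize_t2,
      Term.realize_var] at key
    exact key
  · intro v
    simp only [Formula.realize_iff, Formula.realize_inf, realize_f2, realize_t2,
      Term.realize_var, std_fun₂, std_rel₂]
    exact mem_sep

theorem ext_diff (t a : M) : ext (starFun₂ Obj.diff t a) = ext t \ ext a := by
  ext x
  have key := transfer_forall (M := M) (n := 3)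
    ((f2 Obj.Mem (.var 0) (t2 Obj.diff (.var 1) (.var 2))).iff
      (f2 Obj.Mem (.var 0) (.var 1) ⊓ (f2 Obj.Mem (.var 0) (.var 2)).not)) ?_ ![x, t, a]
  · simp only [Formula.realize_iff, Formula.realize_inf, Formula.realize_not, realize_f2,
      realize_t2, Term.realize_var] at key
    exact key
  · intro v
    simp only [Formula.realize_iff, Formula.realize_inf, Formula.realize_not, realize_f2,
      realize_t2, Term.realize_var, std_fun₂, std_rel₂]
    exact mem_sep

theorem IsInternalCode.inter {t : M} (ht : IsInternalCode t) (a : M) :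
    IsInternalCode (starFun₂ Obj.inter t a) := by
  obtain ⟨n, ht⟩ := ht
  refine ⟨n, ?_⟩
  have key := transfer_forall (M := M) (n := 2)
    ((f1 (Obj.IsSetOfLevel n) (.var 0)).imp
      (f1 (Obj.IsSetOfLevel n) (t2 Obj.inter (.var 0) (.var 1)))) ?_ ![t, a]
  · simp only [Formula.realize_imp, realize_f1, realize_t2, Term.realize_var] at key
    exact key ht
  · intro v
    simp only [Formula.realize_imp, realize_f1, realize_t2, Term.realize_var, std_fun₂, std_rel₁]
    generalize v 0 = t
    rintro ⟨A, rfl⟩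
    exact ⟨_, rfl⟩

theorem IsInternalCode.diff {t : M} (ht : IsInternalCode t) (a : M) :
    IsInternalCode (starFun₂ Obj.diff t a) := by
  obtain ⟨n, ht⟩ := ht
  refine ⟨n, ?_⟩
  have key := transfer_forall (M := M) (n := 2)
    ((f1 (Obj.IsSetOfLevel n) (.var 0)).imp
      (f1 (Obj.IsSetOfLevel n) (t2 Obj.diff (.var 0) (.var 1)))) ?_ ![t, a]
  · simp only [Formula.realize_imp, realize_f1, realize_t2, Term.realize_var] at key
    exact key ht
  · intro v
    simp only [Formula.realize_imp, realize_f1, realize_t2, Term.realize_var, std_fun₂, std_rel₁]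
    generalize v 0 = t
    rintro ⟨A, rfl⟩
    exact ⟨_, rfl⟩

/-- `k` is a natural number and `t` is a set of natural numbers below `k`. -/
def Below (t k : Obj) : Prop :=
  Obj.IsNat k ∧ (∃ n, Obj.IsSetOfLevel n t) ∧ ∀ x, Obj.Mem x t → Obj.IsNat x ∧ Obj.Lt x k

theorem star_below {t k : M} (hk : IsHypernat k) (ht : IsInternalCode t)
    (h : ∀ x ∈ ext t, IsHypernat x ∧ HLt x k) : starRel₂ Below t k := by
  obtain ⟨n, ht⟩ := ht
  let w : Obj → Obj → Obj := fun t k => by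
    classical
    exact if h : ∃ x, Obj.Mem x t ∧ ¬ (Obj.IsNat x ∧ Obj.Lt x k) then h.choose else t
  have key := transfer_forall (M := M) (n := 2)
    ((f1 Obj.IsNat (.var 1) ⊓ f1 (Obj.IsSetOfLevel n) (.var 0) ⊓
      (f2 Obj.Mem (t2 w (.var 0) (.var 1)) (.var 0)).imp
        (f1 Obj.IsNat (t2 w (.var 0) (.var 1)) ⊓
          f2 Obj.Lt (t2 w (.var 0) (.var 1)) (.var 1))).imp
      (f2 Below (.var 0) (.var 1))) ?_ ![t, k]
  · simp only [Formula.realize_imp, Formula.realize_inf, realize_f1, realize_f2, realize_t2,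
      Term.realize_var] at key
    exact key ⟨⟨hk, ht⟩, fun hw => h _ hw⟩
  · intro v
    simp only [Formula.realize_imp, Formula.realize_inf, realize_f1, realize_f2, realize_t2,
      Term.realize_var, std_fun₂, std_rel₁, std_rel₂]
    generalize v 0 = t
    generalize v 1 = k
    rintro ⟨⟨hk, ht⟩, hw⟩
    refine ⟨hk, ⟨n, ht⟩, ?_⟩
    by_contra hne
    push Not at hne
    obtain ⟨x, hx1, hx2⟩ := hne
    have hex : ∃ x, Obj.Mem x t ∧ ¬ (Obj.IsNat x ∧ Obj.Lt x k) :=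
      ⟨x, hx1, fun hx => hx2 hx.1 hx.2⟩
    have hwe : w t k = hex.choose := dif_pos hex
    rw [hwe] at hw
    exact hex.choose_spec.2 (hw hex.choose_spec.1)

theorem finite_of_below {n m : ℕ} {A : Set (Level n)} (h : Below (Obj.set A) (Obj.real m)) :
    A.Finite ∧ A.ncard ≤ m := by
  obtain ⟨-, -, h⟩ := h
  cases n with
  | succ n =>
    have hA : A = ∅ := by
      refine Set.eq_empty_of_forall_notMem fun x hx => ?_
      obtain ⟨⟨j, hj⟩, -⟩ := h ⟨n + 1, x⟩ (mem_set.2 hx)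
      cases hj
    rw [hA]
    exact ⟨Set.finite_empty, by rw [Set.ncard_empty]; exact Nat.zero_le m⟩
  | zero =>
    let c : ℕ → Level 0 := fun j => ((j : ℝ) : Level 0)
    have hA : A ⊆ ((Finset.range m : Finset ℕ) : Set ℕ).image c := by
      intro x hx
      obtain ⟨⟨j, hj⟩, hlt⟩ := h ⟨0, x⟩ (mem_set.2 hx)
      cases hj
      have : (j : ℝ) < m := lt_real.1 hlt
      exact ⟨j, by simpa using this, rfl⟩
    have hf : (((Finset.range m : Finset ℕ) : Set ℕ).image c).Finite :=
      (Finset.finite_toSet _).image c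
    refine ⟨hf.subset hA, (Set.ncard_le_ncard hA hf).trans ?_⟩
    refine (Set.ncard_image_le (Finset.finite_toSet _)).trans ?_
    simp

theorem card_split {t k : M} (h : starRel₂ Below t k) (a : M) :
    starFun₂ Obj.add (starFun₂ Obj.div (starFun₁ Obj.card (starFun₂ Obj.inter t a)) k)
      (starFun₂ Obj.div (starFun₁ Obj.card (starFun₂ Obj.diff t a)) k) =
        starFun₂ Obj.div (starFun₁ Obj.card t) k := by
  have key := transfer_forall (M := M) (n := 3)
    ((f2 Below (.var 0) (.var 1)).imp
      (Term.equal (t2 Obj.add (t2 Obj.div (t1 Obj.card (t2 Obj.inter (.var 0) (.var 2))) (.var 1))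
        (t2 Obj.div (t1 Obj.card (t2 Obj.diff (.var 0) (.var 2))) (.var 1)))
        (t2 Obj.div (t1 Obj.card (.var 0)) (.var 1)))) ?_ ![t, k, a]
  · simp only [Formula.realize_imp, Formula.realize_equal, realize_f2, realize_t2, realize_t1,
      Term.realize_var] at key
    exact key h
  · intro v
    simp only [Formula.realize_imp, Formula.realize_equal, realize_f2, realize_t2, realize_t1,
      Term.realize_var, std_fun₂, std_fun₁, std_rel₂]
    generalize v 0 = t
    generalize v 1 = k
    generalize v 2 = a
    intro hb
    obtain ⟨⟨m, rfl⟩, ⟨n, A, rfl⟩, -⟩ := id hb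
    have hA := (finite_of_below hb).1
    have h1 := Set.ncard_inter_add_ncard_sdiff_eq_ncard A {x | Obj.Mem ⟨n, x⟩ a} hA
    change Obj.real (((A ∩ {x | Obj.Mem ⟨n, x⟩ a}).ncard : ℝ) / m +
      ((A \ {x | Obj.Mem ⟨n, x⟩ a}).ncard : ℝ) / m) = Obj.real ((A.ncard : ℝ) / m)
    rw [← h1, Nat.cast_add, add_div]

theorem card_bounds {t k : M} (h : starRel₂ Below t k) :
    HLe (star (Obj.real 0)) (starFun₂ Obj.div (starFun₁ Obj.card t) k) ∧
      HLe (starFun₂ Obj.div (starFun₁ Obj.card t) k) (star (Obj.real 1)) := by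
  have key := transfer_forall (M := M) (n := 2)
    ((f2 Below (.var 0) (.var 1)).imp
      (f2 Obj.Le (tc (Obj.real 0)) (t2 Obj.div (t1 Obj.card (.var 0)) (.var 1)) ⊓
        f2 Obj.Le (t2 Obj.div (t1 Obj.card (.var 0)) (.var 1)) (tc (Obj.real 1)))) ?_ ![t, k]
  · simp only [Formula.realize_imp, Formula.realize_inf, realize_f2, realize_t2, realize_t1,
      realize_tc, Term.realize_var] at key
    exact key h
  · intro v
    simp only [Formula.realize_imp, Formula.realize_inf, realize_f2, realize_t2, realize_t1,
      realize_tc, Term.realize_var, std_fun₂, std_fun₁, std_star, std_rel₂]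
    generalize v 0 = t
    generalize v 1 = k
    intro hb
    obtain ⟨⟨m, rfl⟩, ⟨n, A, rfl⟩, -⟩ := id hb
    have hA : (A.ncard : ℝ) ≤ m := by exact_mod_cast (finite_of_below hb).2
    exact ⟨le_real.2 (by positivity), le_real.2 (div_le_one_of_le₀ hA (by positivity))⟩

theorem le_one_of_star {r : ℝ} {z : M} (h : HLe (star (Obj.real r)) z)
    (h' : HLe z (star (Obj.real 1))) : r ≤ 1 := by
  by_contra hr
  have key := transfer_forall (M := M) (n := 1)
    (((f2 Obj.Le (tc (Obj.real r)) (.var 0)) ⊓ (f2 Obj.Le (.var 0) (tc (Obj.real 1)))).not) ?_ ![z]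
  · simp only [Formula.realize_not, Formula.realize_inf, realize_f2, realize_tc,
      Term.realize_var] at key
    exact key ⟨h, h'⟩
  · intro v
    simp only [Formula.realize_not, Formula.realize_inf, realize_f2, realize_tc,
      Term.realize_var, std_star, std_rel₂]
    generalize v 0 = z
    rintro ⟨⟨a, b, ha, rfl, hab⟩, hb⟩
    cases ha
    exact hr (hab.trans (le_real.1 hb))

theorem star_add_le {r s : ℝ} {x y : M} (h : HLe (star (Obj.real r)) x)
    (h' : HLe (star (Obj.real s)) y) : HLe (star (Obj.real (r + s))) (starFun₂ Obj.add x y) := by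
  have key := transfer_forall (M := M) (n := 2)
    (((f2 Obj.Le (tc (Obj.real r)) (.var 0)) ⊓ (f2 Obj.Le (tc (Obj.real s)) (.var 1))).imp
      (f2 Obj.Le (tc (Obj.real (r + s))) (t2 Obj.add (.var 0) (.var 1)))) ?_ ![x, y]
  · simp only [Formula.realize_imp, Formula.realize_inf, realize_f2, realize_tc, realize_t2,
      Term.realize_var] at key
    exact key ⟨h, h'⟩
  · intro v
    simp only [Formula.realize_imp, Formula.realize_inf, realize_f2, realize_tc, realize_t2,
      Term.realize_var, std_star, std_rel₂, std_fun₂]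
    generalize v 0 = x
    generalize v 1 = y
    rintro ⟨⟨a, b, ha, rfl, hab⟩, ⟨c, d, hc, rfl, hcd⟩⟩
    cases ha
    cases hc
    exact le_real.2 (add_le_add hab hcd)

theorem st_nonneg {x : M} (h0 : HLe (star (Obj.real 0)) x) (h1 : HLe x (star (Obj.real 1))) :
    0 ≤ st x :=
  le_csSup ⟨1, fun _ hr => le_one_of_star hr h1⟩ h0

theorem st_add_le {x y : M} (hx : HLe (star (Obj.real 0)) x) (hy : HLe (star (Obj.real 0)) y)
    (h1 : HLe (starFun₂ Obj.add x y) (star (Obj.real 1))) :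
    st x + st y ≤ st (starFun₂ Obj.add x y) := by
  have hz : BddAbove {r : ℝ | HLe (star (Obj.real r)) (starFun₂ Obj.add x y)} :=
    ⟨1, fun _ hr => le_one_of_star hr h1⟩
  have h : ∀ r s : ℝ, HLe (star (Obj.real r)) x → HLe (star (Obj.real s)) y →
      r + s ≤ st (starFun₂ Obj.add x y) := fun r s hr hs => le_csSup hz (star_add_le hr hs)
  have h2 : ∀ r : ℝ, HLe (star (Obj.real r)) x → st y ≤ st (starFun₂ Obj.add x y) - r :=
    fun r hr => csSup_le ⟨0, hy⟩ fun s hs => by linarith [h r s hr hs]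
  have h3 : st x ≤ st (starFun₂ Obj.add x y) - st y :=
    csSup_le ⟨0, hx⟩ fun r hr => by linarith [h2 r hr]
  linarith

end Transfer

/-! ### The hyperfinite cycle and its Loeb space -/

/-- The hyperfinite set `K = {0, …, k - 1}`. -/
structure Cycle (k : Hypernat M) where
  /-- the underlying element of the model -/
  val : M
  isHypernat : IsHypernat val
  lt : HLt val k.val

namespace Cycle

variable (k : Hypernat M)

open Classical in
/-- The rotation of `K`: `x ↦ x + 1` if `x < k - 1`, and `x ↦ 0` otherwise. -/
noncomputable def rotation (x : Cycle k) : Cycle k :=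
  if h : HLt x.val (starFun₂ Obj.sub k.val (star (Obj.real 1))) then
    ⟨starFun₂ Obj.add x.val (star (Obj.real 1)), (succ_mem x.isHypernat h).1,
      (succ_mem x.isHypernat h).2⟩
  else ⟨star (Obj.real 0), (zero_mem x.isHypernat x.lt).1, (zero_mem x.isHypernat x.lt).2⟩

theorem val_injective : Function.Injective (val : Cycle k → M) := by
  rintro ⟨x, _, _⟩ ⟨y, _, _⟩ h
  cases h
  rfl

/-- The element `a` of the model stands for the internal subset `A` of `K`. -/
def IsCodeOf (a : M) (A : Set (Cycle k)) : Prop :=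
  IsInternalCode a ∧ ext a = val '' A

/-- The algebra of all internal subsets of `K`. -/
def internalSets : Set (Set (Cycle k)) := {A | ∃ a : M, IsCodeOf k a A}

/-- The hyperreal `Card(A) / k`, for the internal subset `A` of `K` that `a` stands for; here
`Card` is the extension of the function that counts the elements of finite sets. -/
noncomputable def count (a : M) : M := starFun₂ Obj.div (starFun₁ Obj.card a) k.val

/-- The set function `A ↦ °(Card(A) / k)` on internal sets, with value `∞` at all other sets.
(A nonempty internal set has only one code, and all codes of `∅` have cardinality `0`.) -/
noncomputable def stdCount (A : Set (Cycle k)) : ℝ≥0∞ :=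
  ⨅ (a : M) (_ : IsCodeOf k a A), ENNReal.ofReal (st (count k a))

/-- The outer measure obtained by covering sets with countably many internal sets. -/
noncomputable def loebOuter : OuterMeasure (Cycle k) := OuterMeasure.boundedBy (stdCount k)

/-- The `σ`-algebra generated by the internal subsets of `K`. -/
instance : MeasurableSpace (Cycle k) := MeasurableSpace.generateFrom (internalSets k)

theorem generate_le_caratheodory :
    (inferInstance : MeasurableSpace (Cycle k)) ≤ (loebOuter k).caratheodory := by
  refine MeasurableSpace.generateFrom_le ?_
  rintro A ⟨a, ha⟩
  refine OuterMeasure.boundedBy_caratheodory fun T => ?_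
  refine le_iInf₂ fun t ht => ?_
  have hi : IsCodeOf k (starFun₂ Obj.inter t a) (T ∩ A) :=
    ⟨ht.1.inter a, by
      rw [ext_inter, ht.2, ha.2, Set.image_inter (val_injective k)]⟩
  have hd : IsCodeOf k (starFun₂ Obj.diff t a) (T \ A) :=
    ⟨ht.1.diff a, by
      rw [ext_diff, ht.2, ha.2, Set.image_sdiff (val_injective k)]⟩
  have hb : ∀ (b : M) (B : Set (Cycle k)), IsCodeOf k b B → starRel₂ Below b k.val := by
    intro b B h
    refine star_below k.isHypernat h.1 fun x hx => ?_
    rw [h.2] at hx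
    obtain ⟨y, -, rfl⟩ := hx
    exact ⟨y.isHypernat, y.lt⟩
  have bi := card_bounds (hb _ _ hi)
  have bd := card_bounds (hb _ _ hd)
  have bt := card_bounds (hb _ _ ht)
  have hs := card_split (hb _ _ ht) a
  calc stdCount k (T ∩ A) + stdCount k (T \ A)
      ≤ ENNReal.ofReal (st (count k (starFun₂ Obj.inter t a))) +
          ENNReal.ofReal (st (count k (starFun₂ Obj.diff t a))) :=
        add_le_add
          (iInf₂_le (f := fun b _ => ENNReal.ofReal (st (count k b))) _ hi)
          (iInf₂_le (f := fun b _ => ENNReal.ofReal (st (count k b))) _ hd)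
    _ = ENNReal.ofReal (st (count k (starFun₂ Obj.inter t a)) +
          st (count k (starFun₂ Obj.diff t a))) :=
        (ENNReal.ofReal_add (st_nonneg bi.1 bi.2) (st_nonneg bd.1 bd.2)).symm
    _ ≤ ENNReal.ofReal (st (count k t)) := by
        refine ENNReal.ofReal_le_ofReal ?_
        have := st_add_le bi.1 bd.1 (by rw [hs]; exact bt.2)
        rwa [hs] at this

/-- The Loeb measure on the `σ`-algebra generated by the internal sets. -/
noncomputable def loeb : Measure (Cycle k) :=
  (loebOuter k).toMeasure (generate_le_caratheodory k)

/-- The set `K` with the completion of this `σ`-algebra. -/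
abbrev LoebSpace : Type _ := NullMeasurableSpace (Cycle k) (loeb k)

/-- The Loeb measure on the completed `σ`-algebra. -/
noncomputable def loebMeasure : Measure (LoebSpace k) := (loeb k).completion

/-- The rotation as a self-map of the Loeb space. -/
noncomputable def loebRotation : LoebSpace k → LoebSpace k := rotation k

end Cycle


end Model
end NSA

/-! ## The pointwise ergodic theorem of Birkhoff -/

namespace MeasureTheory

variable {α : Type*}

/-! The proof has two independent halves: Birkhoff's theorem for an arbitrary measure preserving map
of a probability space, and the verification that the Loeb space of the cycle with its rotation is
such a system.

For Birkhoff's theorem let `M n` be the maximum of the first `n + 1` Birkhoff sums of `h`, and let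
`A` be the set where these maxima are unbounded. `A` is invariant, and on it `M (n + 1) - M n ∘ f`
is eventually equal to `h`, with an integrable bound independent of `n`. By invariance its integral
over `A` equals that of `M (n + 1) - M n ≥ 0`, so `∫ h ≥ 0` over `A`
(`setIntegral_birkhoffUnbounded_nonneg`). For `h = g - E[g | invariants] - ε` that integral is `-ε
μ(A)`, hence `A` is null; off `A` the sums are bounded above and the averages of `h` have upper
limit at most `0`. Using `-g` as well gives convergence to the conditional expectation, which is
integrable with the integral of `g`.

For the Loeb space, saturation reduces a countable internal cover of an internal set to a finite one
(`exists_finset_cover`), so finite subadditivity of the counting measure suffices for the outer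
measure to extend it (`loebOuter_eq_stdCount`). Transfer of the corresponding fact about finite sets
shows that rotation preimages of internal sets are internal of equal cardinality; as internal sets
form a generating π-system, the rotation preserves the Loeb measure, and then its completion. -/

/-- The maximum of the Birkhoff sums of lengths `1, …, n + 1`, defined by recursion. -/
noncomputable def birkhoffMax (f : α → α) (h : α → ℝ) : ℕ → α → ℝ
  | 0, x => h x
  | n + 1, x => h x + max 0 (birkhoffMax f h n (f x))

theorem birkhoffMax_le_succ (f : α → α) (h : α → ℝ) (n : ℕ) (x : α) :
    birkhoffMax f h n x ≤ birkhoffMax f h (n + 1) x := by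
  induction n generalizing x with
  | zero => simp [birkhoffMax]
  | succ n ih =>
    have := max_le_max (le_refl (0 : ℝ)) (ih (f x))
    simp only [birkhoffMax] at this ⊢
    linarith

theorem birkhoffMax_mono (f : α → α) (h : α → ℝ) (x : α) :
    Monotone fun n => birkhoffMax f h n x :=
  monotone_nat_of_le_succ fun n => birkhoffMax_le_succ f h n x

theorem birkhoffSum_le_birkhoffMax (f : α → α) (h : α → ℝ) (n : ℕ) (x : α) :
    birkhoffSum f h (n + 1) x ≤ birkhoffMax f h n x := by
  induction n generalizing x with
  | zero => simp [birkhoffMax]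
  | succ n ih =>
    rw [birkhoffSum_succ']
    exact add_le_add le_rfl ((ih (f x)).trans (le_max_right _ _))

/-- The set of points at which the Birkhoff sums are not bounded above. -/
def birkhoffUnbounded (f : α → α) (h : α → ℝ) : Set α :=
  {x | ∀ N : ℕ, ∃ n, (N : ℝ) ≤ birkhoffMax f h n x}

/-- By the recursion, the suprema of the sums at `x` and at `f x` are infinite together. -/
theorem preimage_birkhoffUnbounded (f : α → α) (h : α → ℝ) :
    f ⁻¹' birkhoffUnbounded f h = birkhoffUnbounded f h := by
  ext x
  constructor
  · intro hx N
    obtain ⟨m, hm⟩ := exists_nat_ge (N - h x)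
    obtain ⟨n, hn⟩ := hx m
    refine ⟨n + 1, ?_⟩
    have := le_max_right 0 (birkhoffMax f h n (f x))
    simp only [birkhoffMax]
    linarith
  · intro hx N
    -- The extra `1` excludes the case in which the maximum in the recursion is `0`.
    obtain ⟨m, hm⟩ := exists_nat_ge (h x + N + 1)
    obtain ⟨n, hn⟩ := hx m
    refine ⟨n, ?_⟩
    have h1 := hn.trans (birkhoffMax_le_succ f h n x)
    simp only [birkhoffMax] at h1
    rcases max_choice 0 (birkhoffMax f h n (f x)) with h2 | h2
    · have : (0 : ℝ) ≤ N := N.cast_nonneg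
      linarith
    · linarith

/-- The point `f x` lies in the set too, so `birkhoffMax f h n (f x)` is eventually nonnegative; the
truncation at `0` then disappears and the difference is exactly `h x`. -/
theorem tendsto_birkhoffMax_sub (f : α → α) (h : α → ℝ) {x : α} (hx : x ∈ birkhoffUnbounded f h) :
    Tendsto (fun n => birkhoffMax f h (n + 1) x - birkhoffMax f h n (f x)) atTop (𝓝 (h x)) := by
  rw [← preimage_birkhoffUnbounded] at hx
  obtain ⟨n, hn⟩ := hx 0
  refine tendsto_const_nhds.congr' ?_
  filter_upwards [eventually_ge_atTop n] with m hm
  have h1 : 0 ≤ birkhoffMax f h m (f x) := by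
    simpa using hn.trans (birkhoffMax_mono f h (f x) hm)
  simp [birkhoffMax, max_eq_right h1]

/-- The difference is `h x` plus the negative part of `birkhoffMax f h n (f x)`, which is controlled
by the first sum `h (f x)`. This is the bound for dominated convergence. -/
theorem abs_birkhoffMax_sub_le (f : α → α) (h : α → ℝ) (n : ℕ) (x : α) :
    |birkhoffMax f h (n + 1) x - birkhoffMax f h n (f x)| ≤ |h x| + |h (f x)| := by
  have h1 : h (f x) ≤ birkhoffMax f h n (f x) := birkhoffMax_mono f h (f x) (Nat.zero_le n)
  have h2 : |max 0 (birkhoffMax f h n (f x)) - birkhoffMax f h n (f x)| ≤ |h (f x)| := by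
    rcases le_total 0 (birkhoffMax f h n (f x)) with h3 | h3
    · simp [max_eq_right h3]
    · rw [max_eq_left h3, zero_sub, abs_neg, abs_of_nonpos h3,
        abs_of_nonpos (h1.trans h3)]
      linarith
  simp only [birkhoffMax, add_sub_assoc]
  exact (abs_add_le _ _).trans (by gcongr)

theorem eventually_birkhoffAverage_le (f : α → α) (h : α → ℝ) {x : α}
    (hx : x ∉ birkhoffUnbounded f h) {δ : ℝ} (hδ : 0 < δ) :
    ∀ᶠ n : ℕ in atTop, birkhoffAverage ℝ f h n x ≤ δ := by
  simp only [birkhoffUnbounded, Set.mem_ofPred_eq, not_forall, not_exists, not_le] at hx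
  obtain ⟨N, hN⟩ := hx
  obtain ⟨m, hm⟩ := exists_nat_ge (N / δ)
  filter_upwards [eventually_ge_atTop (m + 1)] with n hn
  obtain ⟨j, rfl⟩ := Nat.exists_eq_add_of_le' (le_trans (Nat.le_add_left 1 m) hn)
  have h1 : birkhoffSum f h (j + 1) x ≤ N :=
    (birkhoffSum_le_birkhoffMax f h j x).trans (hN j).le
  have h2 : (m : ℝ) ≤ ((j + 1 : ℕ) : ℝ) := by exact_mod_cast (Nat.le_succ m).trans hn
  have h3 : (0 : ℝ) < ((j + 1 : ℕ) : ℝ) := by positivity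
  rw [birkhoffAverage, smul_eq_mul, inv_mul_le_iff₀ h3]
  rw [div_le_iff₀ hδ] at hm
  exact h1.trans (hm.trans (by gcongr))

/-! ### The maximal inequality on the set of unbounded sums. -/

variable [MeasurableSpace α] {μ : Measure α} {f : α → α}

theorem measurable_birkhoffMax (hf : Measurable f) {h : α → ℝ} (hh : Measurable h) (n : ℕ) :
    Measurable (birkhoffMax f h n) := by
  induction n with
  | zero => exact hh
  | succ n ih => exact hh.add (measurable_const.max (ih.comp hf))

theorem measurableSet_birkhoffUnbounded (hf : Measurable f) {h : α → ℝ} (hh : Measurable h) :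
    MeasurableSet (birkhoffUnbounded f h) := by
  simp only [birkhoffUnbounded, Set.ofPred_forall, Set.ofPred_exists]
  exact .iInter fun N => .iUnion fun n =>
    measurableSet_le measurable_const (measurable_birkhoffMax hf hh n)

theorem integrable_birkhoffMax (hf : MeasurePreserving f μ μ) {h : α → ℝ} (hh : Integrable h μ)
    (n : ℕ) : Integrable (birkhoffMax f h n) μ := by
  induction n with
  | zero => exact hh
  | succ n ih =>
    have h1 : Integrable (fun x => birkhoffMax f h n (f x)) μ := hf.integrable_comp_of_integrable ih
    exact hh.add (by simpa [max_comm] using h1.pos_part)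

/-- The integral of `h` over the set where the Birkhoff sums of `h` are unbounded is nonnegative. -/
theorem setIntegral_birkhoffUnbounded_nonneg (hf : MeasurePreserving f μ μ) {h : α → ℝ}
    (hm : Measurable h) (hh : Integrable h μ) : 0 ≤ ∫ x in birkhoffUnbounded f h, h x ∂μ := by
  set A := birkhoffUnbounded f h with hA
  have hAm : MeasurableSet A := measurableSet_birkhoffUnbounded hf.measurable hm
  have hcomp : ∀ n, Integrable (fun x => birkhoffMax f h n (f x)) μ := fun n =>
    hf.integrable_comp_of_integrable (integrable_birkhoffMax hf hh n)
  have hlim : Tendsto (fun n => ∫ x in A, birkhoffMax f h (n + 1) x - birkhoffMax f h n (f x) ∂μ)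
      atTop (𝓝 (∫ x in A, h x ∂μ)) := by
    refine tendsto_integral_of_dominated_convergence (fun x => |h x| + |h (f x)|) ?_ ?_ ?_ ?_
    · exact fun n => ((integrable_birkhoffMax hf hh _).sub (hcomp n)).aestronglyMeasurable.restrict
    · exact (hh.abs.add (hcomp 0).abs).integrableOn
    · exact fun n => .of_forall fun x => abs_birkhoffMax_sub_le f h n x
    · exact (ae_restrict_iff' hAm).2 (.of_forall fun x hx => tendsto_birkhoffMax_sub f h hx)
  refine ge_of_tendsto' hlim fun n => ?_
  -- Both `A` and `μ` are invariant under `f`, so the composition with `f` can be dropped under the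
  -- integral.
  have hshift : ∫ x in A, birkhoffMax f h n (f x) ∂μ = ∫ x in A, birkhoffMax f h n x ∂μ := by
    have h1 : AEStronglyMeasurable (A.indicator (birkhoffMax f h n)) (μ.map f) := by
      rw [hf.map_eq]
      exact ((integrable_birkhoffMax hf hh n).indicator hAm).aestronglyMeasurable
    rw [← integral_indicator hAm, ← integral_indicator hAm]
    conv_rhs => rw [← hf.map_eq, integral_map hf.aemeasurable h1]
    refine integral_congr_ae (.of_forall fun x => ?_)
    have : f x ∈ A ↔ x ∈ A := by
      conv_rhs => rw [hA, ← preimage_birkhoffUnbounded]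
      rfl
    by_cases hx : x ∈ A
    · simp [Set.indicator_of_mem, hx, this.2 hx]
    · simp [Set.indicator_of_notMem, hx, mt this.1 hx]
  rw [integral_sub (integrable_birkhoffMax hf hh _).integrableOn (hcomp n).integrableOn, hshift,
    sub_nonneg]
  exact setIntegral_mono (integrable_birkhoffMax hf hh _).integrableOn
    (integrable_birkhoffMax hf hh _).integrableOn fun x => birkhoffMax_le_succ f h n x

/-! ### Almost everywhere convergence. -/

variable [IsProbabilityMeasure μ]

/-- One `ε` is subtracted in `h` to force its unbounded set to be null; the other is the slack in
the averages of `h` off that set. -/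
theorem ae_eventually_birkhoffAverage_le_add (hf : MeasurePreserving f μ μ) {g : α → ℝ}
    (hm : Measurable g) (hg : Integrable g μ) {ε : ℝ} (hε : 0 < ε) :
    ∀ᵐ x ∂μ, ∀ᶠ n : ℕ in atTop, birkhoffAverage ℝ f g n x ≤
      (μ[g|MeasurableSpace.invariants f]) x + 2 * ε := by
  have hle := MeasurableSpace.invariants_le f
  set G := μ[g|MeasurableSpace.invariants f] with hG
  have hGm : Measurable[MeasurableSpace.invariants f] G := stronglyMeasurable_condExp.measurable
  have hinv : G ∘ f = G := MeasurableSpace.comp_eq_of_measurable_invariants hGm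
  have hGi : Integrable G μ := integrable_condExp
  set U : α → ℝ := fun x => G x + ε with hU
  have hUinv : U ∘ f = U := funext fun x => congrArg (· + ε) (congrFun hinv x)
  have hUi : Integrable U μ := hGi.add (integrable_const ε)
  set h : α → ℝ := g - U with hh
  have hhm : Measurable h := hm.sub ((hGm.mono hle le_rfl).add measurable_const)
  have hhi : Integrable h μ := hg.sub hUi
  set A := birkhoffUnbounded f h with hA
  have hAm : MeasurableSet A := measurableSet_birkhoffUnbounded hf.measurable hhm
  have h0 : ∫ x in A, h x ∂μ = - (ε * μ.real A) := by
    rw [hh, integral_sub' hg.integrableOn hUi.integrableOn, hU,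
      integral_add hGi.integrableOn (integrable_const ε).integrableOn,
      setIntegral_condExp hle hg ⟨hAm, preimage_birkhoffUnbounded f h⟩]
    simp [mul_comm]
  have h1 := setIntegral_birkhoffUnbounded_nonneg hf hhm hhi
  rw [← hA, h0] at h1
  have h2 : μ.real A = 0 := by
    have := measureReal_nonneg (μ := μ) (s := A)
    nlinarith
  have h3 : μ A = 0 := by simpa [measureReal_def, ENNReal.toReal_eq_zero_iff] using h2
  filter_upwards [measure_eq_zero_iff_ae_notMem.1 h3] with x hx
  -- Averages of the invariant function `U` equal `U` only for `n ≠ 0`.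
  filter_upwards [eventually_birkhoffAverage_le f h hx hε, eventually_gt_atTop 0] with n hn hn0
  rw [hh, birkhoffAverage_sub, Pi.sub_apply, Pi.sub_apply,
    birkhoffAverage_of_comp_eq ℝ hUinv (Nat.cast_ne_zero.2 hn0.ne')] at hn
  simp only [hU] at hn
  linarith

/-- **Pointwise ergodic theorem**: the Birkhoff averages of an integrable function converge almost
everywhere to its conditional expectation given the invariant sets. -/
theorem ae_tendsto_birkhoffAverage_condExp (hf : MeasurePreserving f μ μ) {g : α → ℝ}
    (hg : Integrable g μ) :
    ∀ᵐ x ∂μ, Tendsto (fun n : ℕ => birkhoffAverage ℝ f g n x) atTop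
      (𝓝 ((μ[g|MeasurableSpace.invariants f]) x)) := by
  -- Passing to a measurable representative changes countably many averages, each only on a null set
  -- because `f` preserves `μ`.
  wlog hm : Measurable g generalizing g
  · have hmk := hg.aestronglyMeasurable.ae_eq_mk
    have h1 := this (hg.congr hmk) hg.aestronglyMeasurable.stronglyMeasurable_mk.measurable
    have h2 := ae_all_iff.2 fun n => 
      hf.quasiMeasurePreserving.birkhoffAverage_ae_eq_of_ae_eq ℝ hmk n
    filter_upwards [h1, h2, condExp_congr_ae (m := MeasurableSpace.invariants f) hmk]
      with x hx1 hx2 hx3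
    simpa only [hx2, hx3] using hx1
  have hpos : ∀ m : ℕ, (0 : ℝ) < 1 / (m + 1) := fun m => Nat.one_div_pos_of_nat
  -- Only countably many values of `ε` are used, so that one null set serves for all.
  have h1 := ae_all_iff.2 fun m => ae_eventually_birkhoffAverage_le_add hf hm hg (hpos m)
  have h2 := ae_all_iff.2 fun m => ae_eventually_birkhoffAverage_le_add hf hm.neg hg.neg (hpos m)
  filter_upwards [h1, h2, condExp_neg (μ := μ) g (MeasurableSpace.invariants f)] with x hx1 hx2 hx3
  rw [Metric.tendsto_atTop']
  intro δ hδ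
  obtain ⟨m, hm⟩ := exists_nat_one_div_lt (show 0 < δ / 2 by positivity)
  have h3 := (hx1 m).and (hx2 m)
  obtain ⟨N, hN⟩ := eventually_atTop.1 h3
  refine ⟨N, fun n hn => ?_⟩
  obtain ⟨h4, h5⟩ := hN n hn.le
  rw [hx3, birkhoffAverage_neg] at h5
  simp only [Pi.neg_apply] at h5
  rw [Real.dist_eq, abs_lt]
  constructor <;> linarith

end MeasureTheory

namespace NSA

/-! ## Standard facts about sets of natural numbers -/

/-- Since `p` holds only at natural numbers, no element is lost by restricting to level `0`. -/
theorem mem_setOf {p : Obj → Prop} {x : Obj} (hp : p x → Obj.IsNat x) :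
    Obj.Mem x (Obj.set (n := 0) {y | p ⟨0, y⟩}) ↔ p x := by
  constructor
  · rintro ⟨m, z, B, rfl, h2, h3⟩
    cases h2
    exact h3
  · intro h
    obtain ⟨j, rfl⟩ := hp h
    exact mem_set.2 h

/-- The set of all natural numbers below `k`. -/
def initialSegment (k : Obj) : Obj :=
  Obj.set (n := 0) {x | Obj.IsNat ⟨0, x⟩ ∧ Obj.Lt ⟨0, x⟩ k}

theorem mem_initialSegment {x k : Obj} :
    Obj.Mem x (initialSegment k) ↔ Obj.IsNat x ∧ Obj.Lt x k :=
  mem_setOf (p := fun x => Obj.IsNat x ∧ Obj.Lt x k) And.left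

theorem card_initialSegment (m : ℕ) : Obj.card (initialSegment (Obj.real m)) = Obj.real m := by
  have h : {x : ℝ | Obj.IsNat ⟨0, x⟩ ∧ Obj.Lt ⟨0, x⟩ (Obj.real m)} =
      (fun j : ℕ => (j : ℝ)) '' (Finset.range m : Set ℕ) := by
    ext x
    constructor
    · rintro ⟨⟨j, hj⟩, h2⟩
      cases hj
      exact ⟨j, by simpa using Nat.cast_lt.1 (lt_real.1 h2), rfl⟩
    · rintro ⟨j, hj, rfl⟩
      exact ⟨⟨j, rfl⟩, lt_real.2 (by simpa using hj)⟩
  change Obj.real (Set.ncard {x : ℝ | Obj.IsNat ⟨0, x⟩ ∧ Obj.Lt ⟨0, x⟩ (Obj.real m)} : ℕ) = _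
  rw [h, Set.ncard_image_of_injective _ Nat.cast_injective, Set.ncard_coe_finset,
    Finset.card_range]

/-- The condition that the rotation of `{0, …, k - 1}` maps `x` into `a`. -/
def RotatesInto (a k x : Obj) : Prop :=
  Obj.IsNat x ∧ Obj.Lt x k ∧
    ((Obj.Lt x (Obj.sub k (Obj.real 1)) ∧ Obj.Mem (Obj.add x (Obj.real 1)) a) ∨
      (¬ Obj.Lt x (Obj.sub k (Obj.real 1)) ∧ Obj.Mem (Obj.real 0) a))

/-- The preimage of `a` under the rotation of `{0, …, k - 1}`. -/
def rotationPreimage (a k : Obj) : Obj := Obj.set (n := 0) {x | RotatesInto a k ⟨0, x⟩}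

theorem mem_rotationPreimage {a k x : Obj} :
    Obj.Mem x (rotationPreimage a k) ↔ RotatesInto a k x :=
  mem_setOf (p := RotatesInto a k) And.left

theorem rotatesInto_real {A : Set ℝ} {m j : ℕ} :
    RotatesInto (Obj.set (n := 0) A) (Obj.real m) (Obj.real j) ↔
      j < m ∧ ((if j + 1 < m then ((j + 1 : ℕ) : ℝ) else 0) ∈ A) := by
  have h1 : Obj.Lt (Obj.real j) (Obj.real m) ↔ j < m := lt_real.trans Nat.cast_lt
  have h2 : Obj.Lt (Obj.real j) (Obj.sub (Obj.real m) (Obj.real 1)) ↔ j + 1 < m := by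
    refine (lt_real (y := (m : ℝ) - 1)).trans ?_
    rw [lt_sub_iff_add_lt]
    exact_mod_cast Iff.rfl
  have h3 : Obj.Mem (Obj.add (Obj.real j) (Obj.real 1)) (Obj.set (n := 0) A) ↔
      ((j + 1 : ℕ) : ℝ) ∈ A := by
    push_cast
    exact mem_set (n := 0) (x := (j : ℝ) + 1)
  have h4 : Obj.Mem (Obj.real 0) (Obj.set (n := 0) A) ↔ (0 : ℝ) ∈ A := mem_set (n := 0)
  rw [RotatesInto, h1, h2, h3, h4]
  have h5 : Obj.IsNat (Obj.real j) := ⟨j, rfl⟩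
  split_ifs with h <;> simp [h, h5]

/-- The rotation permutes `{0, …, m - 1}`. The level of `a` is not fixed, but above level `1` a set
of natural numbers can only be empty. -/
theorem card_rotationPreimage {a k : Obj} (h : Below a k) :
    Obj.card (rotationPreimage a k) = Obj.card a := by
  obtain ⟨⟨m, rfl⟩, ⟨n, A, rfl⟩, hA⟩ := h
  cases n with
  | succ n =>
    have hE : ∀ x, ¬ Obj.Mem x (Obj.set A) := by
      intro x hx
      obtain ⟨⟨j, rfl⟩, -⟩ := hA x hx
      obtain ⟨l, y, B, h1, h2, -⟩ := hx
      cases h1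
      cases h2
    have h1 : A = ∅ := Set.eq_empty_of_forall_notMem fun x hx => hE _ (mem_set.2 hx)
    have h2 : {x : Level 0 | RotatesInto (Obj.set A) (Obj.real m) ⟨0, x⟩} = ∅ :=
      Set.eq_empty_of_forall_notMem fun x hx => by
        rcases hx.2.2 with h3 | h3 <;> exact hE _ h3.2
    change Obj.real (Set.ncard {x : Level 0 | RotatesInto (Obj.set A) (Obj.real m) ⟨0, x⟩} : ℕ) =
      Obj.real (Set.ncard A : ℕ)
    rw [h1] at h2 ⊢
    rw [h2, Set.ncard_empty, Set.ncard_empty]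
  | zero =>
    change Set ℝ at A
    have hA' : ∀ y ∈ A, ∃ i : ℕ, y = i ∧ i < m := by
      intro y hy
      obtain ⟨⟨i, hi⟩, hlt⟩ := hA ⟨0, y⟩ (mem_set.2 hy)
      cases hi
      exact ⟨i, rfl, Nat.cast_lt.1 (lt_real.1 hlt)⟩
    set B : Set ℝ := {x : ℝ | RotatesInto (Obj.set (n := 0) A) (Obj.real m) (Obj.real x)} with hB
    have hBnat : ∀ x ∈ B, ∃ j : ℕ, x = j ∧ j < m ∧
        ((if j + 1 < m then ((j + 1 : ℕ) : ℝ) else 0) ∈ A) := by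
      intro x hx
      obtain ⟨⟨j, hj⟩, -⟩ := id hx
      cases hj
      exact ⟨j, rfl, rotatesInto_real.1 hx⟩
    have hcard : B.ncard = A.ncard := by
      refine Set.ncard_congr (fun x _ => if x + 1 < (m : ℝ) then x + 1 else 0) ?_ ?_ ?_
      · intro x hx
        obtain ⟨j, rfl, -, h⟩ := hBnat x hx
        exact_mod_cast h
      · intro x y hx hy
        obtain ⟨i, rfl, hi, -⟩ := hBnat x hx
        obtain ⟨j, rfl, hj, -⟩ := hBnat y hy
        intro h
        norm_cast at h ⊢
        split_ifs at h <;> omega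
      · intro y hy
        obtain ⟨i, rfl, hi⟩ := hA' y hy
        -- The point sent to `0` is `m - 1`; the point sent to `i + 1` is `i`.
        rcases i with _ | i
        · refine ⟨((m - 1 : ℕ) : ℝ), rotatesInto_real.2 ⟨by omega, ?_⟩, ?_⟩
          · rw [if_neg (by omega)]
            simpa using hy
          · norm_cast
            rw [if_neg (by omega)]
        · refine ⟨(i : ℝ), rotatesInto_real.2 ⟨by omega, ?_⟩, ?_⟩
          · rw [if_pos hi]
            exact hy
          · norm_cast
            rw [if_pos hi]
    exact congrArg (fun i : ℕ => Obj.real (i : ℝ)) hcard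

theorem card_le_card {a b k : Obj} (ha : Below a k) (hb : Below b k)
    (h : ∀ x, Obj.Mem x a → Obj.Mem x b) :
    Obj.Le (Obj.div (Obj.card a) k) (Obj.div (Obj.card b) k) := by
  obtain ⟨⟨m, rfl⟩, ⟨n, A, rfl⟩, -⟩ := id ha
  obtain ⟨-, ⟨n', B, rfl⟩, -⟩ := id hb
  change Obj.Le (Obj.real ((A.ncard : ℝ) / m)) (Obj.real ((B.ncard : ℝ) / m))
  refine le_real.2 ?_
  rcases A.eq_empty_or_nonempty with hA | ⟨x, hx⟩
  · rw [hA, Set.ncard_empty, Nat.cast_zero, zero_div]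
    positivity
  -- A common element forces the two sets to have the same level.
  · have h1 := h _ (mem_set.2 hx)
    obtain ⟨l, y, C, h2, h3, -⟩ := h1
    cases h2
    cases h3
    have hsub : A ⊆ C := fun z hz => mem_set.1 (h _ (mem_set.2 hz))
    have := Set.ncard_le_ncard hsub (finite_of_below hb).1
    exact div_le_div_of_nonneg_right (Nat.cast_le.2 this) m.cast_nonneg

/-! ## Transfer to nonstandard models -/

section Model

variable {M : Type*} [NonstandardModel M]

open FirstOrder FirstOrder.Language

theorem ext_initialSegment (k : M) :
    ext (starFun₁ initialSegment k) = {x | IsHypernat x ∧ HLt x k} := by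
  ext x
  have key := transfer_forall (M := M) (n := 2)
    ((f2 Obj.Mem (.var 0) (t1 initialSegment (.var 1))).iff
      (f1 Obj.IsNat (.var 0) ⊓ f2 Obj.Lt (.var 0) (.var 1))) ?_ ![x, k]
  · simp only [Formula.realize_iff, Formula.realize_inf, realize_f1, realize_f2, realize_t1,
      Term.realize_var] at key
    exact key
  · intro v
    simp only [Formula.realize_iff, Formula.realize_inf, realize_f1, realize_f2, realize_t1,
      Term.realize_var, std_fun₁, std_rel₁, std_rel₂]
    exact mem_initialSegment

theorem isInternalCode_initialSegment (k : M) : IsInternalCode (starFun₁ initialSegment k) := by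
  refine ⟨0, ?_⟩
  have key := transfer_forall (M := M) (n := 1)
    (f1 (Obj.IsSetOfLevel 0) (t1 initialSegment (.var 0))) ?_ ![k]
  · simp only [realize_f1, realize_t1, Term.realize_var] at key
    exact key
  · intro v
    simp only [realize_f1, realize_t1, Term.realize_var, std_fun₁, std_rel₁]
    exact ⟨_, rfl⟩

theorem card_initialSegment_div {k : M} (hk : IsHypernat k) (h0 : HLt (star (Obj.real 0)) k) :
    starFun₂ Obj.div (starFun₁ Obj.card (starFun₁ initialSegment k)) k = star (Obj.real 1) := by
  have key := transfer_forall (M := M) (n := 1)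
    ((f1 Obj.IsNat (.var 0) ⊓ f2 Obj.Lt (tc (Obj.real 0)) (.var 0)).imp
      (Term.equal (t2 Obj.div (t1 Obj.card (t1 initialSegment (.var 0))) (.var 0))
        (tc (Obj.real 1)))) ?_ ![k]
  · simp only [Formula.realize_imp, Formula.realize_inf, Formula.realize_equal, realize_f1,
      realize_f2, realize_t2, realize_t1, realize_tc, Term.realize_var] at key
    exact key ⟨hk, h0⟩
  · intro v
    simp only [Formula.realize_imp, Formula.realize_inf, Formula.realize_equal, realize_f1,
      realize_f2, realize_t2, realize_t1, realize_tc, Term.realize_var, std_fun₁, std_fun₂,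
      std_rel₁, std_rel₂, std_star]
    generalize v 0 = k
    rintro ⟨⟨m, rfl⟩, h⟩
    rw [card_initialSegment]
    exact congrArg Obj.real (div_self (lt_real.1 h).ne')

theorem mem_ext_rotationPreimage (a k x : M) :
    x ∈ ext (starFun₂ rotationPreimage a k) ↔ IsHypernat x ∧ HLt x k ∧
      ((HLt x (starFun₂ Obj.sub k (star (Obj.real 1))) ∧
          starFun₂ Obj.add x (star (Obj.real 1)) ∈ ext a) ∨
        (¬ HLt x (starFun₂ Obj.sub k (star (Obj.real 1))) ∧ star (Obj.real 0) ∈ ext a)) := by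
  have key := transfer_forall (M := M) (n := 3)
    ((f2 Obj.Mem (.var 2) (t2 rotationPreimage (.var 0) (.var 1))).iff
      (f1 Obj.IsNat (.var 2) ⊓ (f2 Obj.Lt (.var 2) (.var 1) ⊓
        ((f2 Obj.Lt (.var 2) (t2 Obj.sub (.var 1) (tc (Obj.real 1))) ⊓
          f2 Obj.Mem (t2 Obj.add (.var 2) (tc (Obj.real 1))) (.var 0)) ⊔
        ((f2 Obj.Lt (.var 2) (t2 Obj.sub (.var 1) (tc (Obj.real 1)))).not ⊓
          f2 Obj.Mem (tc (Obj.real 0)) (.var 0)))))) ?_ ![a, k, x]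
  · simp only [Formula.realize_iff, Formula.realize_inf, Formula.realize_sup, Formula.realize_not,
      realize_f1, realize_f2, realize_t2, realize_tc, Term.realize_var] at key
    exact key
  · intro v
    simp only [Formula.realize_iff, Formula.realize_inf, Formula.realize_sup, Formula.realize_not,
      realize_f1, realize_f2, realize_t2, realize_tc, Term.realize_var, std_fun₂,
      std_rel₁, std_rel₂, std_star]
    exact mem_rotationPreimage

theorem isInternalCode_rotationPreimage (a k : M) :
    IsInternalCode (starFun₂ rotationPreimage a k) := by
  refine ⟨0, ?_⟩
  have key := transfer_forall (M := M) (n := 2)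
    (f1 (Obj.IsSetOfLevel 0) (t2 rotationPreimage (.var 0) (.var 1))) ?_ ![a, k]
  · simp only [realize_f1, realize_t2, Term.realize_var] at key
    exact key
  · intro v
    simp only [realize_f1, realize_t2, Term.realize_var, std_fun₂, std_rel₁]
    exact ⟨_, rfl⟩

theorem starFun_card_rotationPreimage {a k : M} (h : starRel₂ Below a k) :
    starFun₁ Obj.card (starFun₂ rotationPreimage a k) = starFun₁ Obj.card a := by
  have key := transfer_forall (M := M) (n := 2)
    ((f2 Below (.var 0) (.var 1)).imp
      (Term.equal (t1 Obj.card (t2 rotationPreimage (.var 0) (.var 1)))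
        (t1 Obj.card (.var 0)))) ?_ ![a, k]
  · simp only [Formula.realize_imp, Formula.realize_equal, realize_f2, realize_t2, realize_t1,
      Term.realize_var] at key
    exact key h
  · intro v
    simp only [Formula.realize_imp, Formula.realize_equal, realize_f2, realize_t2, realize_t1,
      Term.realize_var, std_fun₁, std_fun₂, std_rel₂]
    exact card_rotationPreimage

theorem card_div_mono {a b k : M} (ha : starRel₂ Below a k) (hb : starRel₂ Below b k)
    (h : ext a ⊆ ext b) :
    HLe (starFun₂ Obj.div (starFun₁ Obj.card a) k) (starFun₂ Obj.div (starFun₁ Obj.card b) k) := by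
  -- A Skolem function choosing a counterexample to the inclusion; it expresses the inclusion
  -- without a quantifier, so that it can be transferred.
  let w : Obj → Obj → Obj := fun a b => by
    classical
    exact if h : ∃ x, Obj.Mem x a ∧ ¬ Obj.Mem x b then h.choose else a
  have key := transfer_forall (M := M) (n := 3)
    ((f2 Below (.var 0) (.var 2) ⊓ f2 Below (.var 1) (.var 2) ⊓
      (f2 Obj.Mem (t2 w (.var 0) (.var 1)) (.var 0)).imp
        (f2 Obj.Mem (t2 w (.var 0) (.var 1)) (.var 1))).imp
      (f2 Obj.Le (t2 Obj.div (t1 Obj.card (.var 0)) (.var 2))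
        (t2 Obj.div (t1 Obj.card (.var 1)) (.var 2)))) ?_ ![a, b, k]
  · simp only [Formula.realize_imp, Formula.realize_inf, realize_f2, realize_t2, realize_t1,
      Term.realize_var] at key
    exact key ⟨⟨ha, hb⟩, fun hw => h hw⟩
  · intro v
    simp only [Formula.realize_imp, Formula.realize_inf, realize_f2, realize_t2, realize_t1,
      Term.realize_var, std_fun₁, std_fun₂, std_rel₂]
    generalize v 0 = a
    generalize v 1 = b
    rintro ⟨⟨ha, hb⟩, hw⟩
    refine card_le_card ha hb ?_
    by_contra hne
    push Not at hne
    have hwe : w a b = hne.choose := dif_pos hne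
    rw [hwe] at hw
    exact hne.choose_spec.2 (hw hne.choose_spec.1)

/-! ## Standard parts -/

theorem HLe.trans {x y z : M} (h : HLe x y) (h' : HLe y z) : HLe x z := by
  have key := transfer_forall (M := M) (n := 3)
    ((f2 Obj.Le (.var 0) (.var 1) ⊓ f2 Obj.Le (.var 1) (.var 2)).imp
      (f2 Obj.Le (.var 0) (.var 2))) ?_ ![x, y, z]
  · simp only [Formula.realize_imp, Formula.realize_inf, realize_f2, Term.realize_var] at key
    exact key ⟨h, h'⟩
  · intro v
    simp only [Formula.realize_imp, Formula.realize_inf, realize_f2, Term.realize_var, std_rel₂]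
    rintro ⟨⟨a, b, h1, h2, hab⟩, ⟨c, d, h3, h4, hcd⟩⟩
    rw [h2] at h3
    cases h3
    exact ⟨a, d, h1, h4, hab.trans hcd⟩

/-- Elements of `M` need not be hyperreals; the common lower bound ensures that `y` and `z` are. -/
theorem HLe.total {x y z : M} (h : HLe x y) (h' : HLe x z) : HLe y z ∨ HLe z y := by
  have key := transfer_forall (M := M) (n := 3)
    ((f2 Obj.Le (.var 0) (.var 1) ⊓ f2 Obj.Le (.var 0) (.var 2)).imp
      (f2 Obj.Le (.var 1) (.var 2) ⊔ f2 Obj.Le (.var 2) (.var 1))) ?_ ![x, y, z]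
  · simp only [Formula.realize_imp, Formula.realize_inf, Formula.realize_sup, realize_f2,
      Term.realize_var] at key
    exact key ⟨h, h'⟩
  · intro v
    simp only [Formula.realize_imp, Formula.realize_inf, Formula.realize_sup, realize_f2,
      Term.realize_var, std_rel₂]
    rintro ⟨⟨a, b, -, h2, -⟩, ⟨c, d, -, h4, -⟩⟩
    rw [h2, h4, le_real, le_real]
    exact le_total b d

theorem HLe.add {x y x' y' : M} (h : HLe x x') (h' : HLe y y') :
    HLe (starFun₂ Obj.add x y) (starFun₂ Obj.add x' y') := by
  have key := transfer_forall (M := M) (n := 4)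
    ((f2 Obj.Le (.var 0) (.var 2) ⊓ f2 Obj.Le (.var 1) (.var 3)).imp
      (f2 Obj.Le (t2 Obj.add (.var 0) (.var 1)) (t2 Obj.add (.var 2) (.var 3)))) ?_ ![x, y, x', y']
  · simp only [Formula.realize_imp, Formula.realize_inf, realize_f2, realize_t2,
      Term.realize_var] at key
    exact key ⟨h, h'⟩
  · intro v
    simp only [Formula.realize_imp, Formula.realize_inf, realize_f2, realize_t2,
      Term.realize_var, std_rel₂, std_fun₂]
    rintro ⟨⟨a, b, h1, h2, hab⟩, ⟨c, d, h3, h4, hcd⟩⟩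
    rw [h1, h2, h3, h4]
    exact le_real.2 (add_le_add hab hcd)

theorem star_add (r s : ℝ) :
    starFun₂ Obj.add (star (Obj.real r)) (star (Obj.real s)) = (star (Obj.real (r + s)) : M) := by
  have key := transfer_forall (M := M) (n := 0)
    (Term.equal (t2 Obj.add (tc (Obj.real r)) (tc (Obj.real s))) (tc (Obj.real (r + s)))) ?_ ![]
  · simp only [Formula.realize_equal, realize_t2, realize_tc] at key
    exact key
  · intro v
    simp only [Formula.realize_equal, realize_t2, realize_tc, std_fun₂, std_star]
    rfl

theorem star_le_star {r s : ℝ} :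
    HLe (star (Obj.real r) : M) (star (Obj.real s)) ↔ r ≤ s := by
  by_cases h : r ≤ s
  · have key := transfer_forall (M := M) (n := 0)
      (f2 Obj.Le (tc (Obj.real r)) (tc (Obj.real s))) ?_ ![]
    · simp only [realize_f2, realize_tc] at key
      exact ⟨fun _ => h, fun _ => key⟩
    · intro v
      simp only [realize_f2, realize_tc, std_rel₂, std_star]
      exact le_real.2 h
  · have key := transfer_forall (M := M) (n := 0)
      (f2 Obj.Le (tc (Obj.real r)) (tc (Obj.real s))).not ?_ ![]
    · simp only [Formula.realize_not, realize_f2, realize_tc] at key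
      exact ⟨fun h' => absurd h' key, fun h' => absurd h' h⟩
    · intro v
      simp only [Formula.realize_not, realize_f2, realize_tc, std_rel₂, std_star]
      exact fun h' => h (le_real.1 h')

theorem st_star (r : ℝ) : st (star (Obj.real r) : M) = r := by
  have h : {s : ℝ | HLe (star (Obj.real s)) (star (Obj.real r) : M)} = Set.Iic r := by
    ext s
    exact star_le_star
  rw [st, h, csSup_Iic]

theorem bddAbove_star_le {x : M} {r : ℝ} (hx : HLe x (star (Obj.real r))) :
    BddAbove {s : ℝ | HLe (star (Obj.real s)) x} :=
  ⟨r, fun _ hs => star_le_star.1 (HLe.trans hs hx)⟩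

theorem st_mono {x y : M} {r : ℝ} (h0 : HLe (star (Obj.real 0)) x) (h : HLe x y)
    (hy : HLe y (star (Obj.real r))) : st x ≤ st y :=
  csSup_le_csSup (bddAbove_star_le hy) ⟨0, h0⟩ fun _ hs => HLe.trans hs h

/-- The finite bound `s` keeps `st x` from being the default value of an unbounded supremum. -/
theorem le_star_of_st_lt {x : M} {r s : ℝ} (h0 : HLe (star (Obj.real 0)) x)
    (hx : HLe x (star (Obj.real s))) (hr : st x < r) : HLe x (star (Obj.real r)) := by
  have h1 : 0 ≤ st x := le_csSup (bddAbove_star_le hx) h0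
  rcases HLe.total h0 (star_le_star.2 (h1.trans hr.le)) with h | h
  · exact h
  · exact absurd (le_csSup (bddAbove_star_le hx) h) (not_le.2 hr)

/-- Standard parts are suprema of lower bounds, so the upper estimate needs a margin: `x` and `y`
lie below their standard parts plus `ε / 2`. -/
theorem st_add_le_st_add_st {x y : M} {r s : ℝ} (hx0 : HLe (star (Obj.real 0)) x)
    (hx : HLe x (star (Obj.real r))) (hy0 : HLe (star (Obj.real 0)) y)
    (hy : HLe y (star (Obj.real s))) : st (starFun₂ Obj.add x y) ≤ st x + st y := by
  refine le_of_forall_pos_le_add fun ε hε => ?_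
  have h1 := le_star_of_st_lt hx0 hx (lt_add_of_pos_right (st x) (half_pos hε))
  have h2 := le_star_of_st_lt hy0 hy (lt_add_of_pos_right (st y) (half_pos hε))
  have h3 := HLe.add h1 h2
  rw [star_add] at h3
  have h4 := HLe.add hx0 hy0
  rw [star_add, add_zero] at h4
  refine csSup_le ⟨0, h4⟩ fun t ht => ?_
  have := star_le_star.1 (HLe.trans ht h3)
  linarith

end Model

end NSA

namespace NSA.Cycle

variable {M : Type*} [NonstandardModel M] {k : Hypernat M}

/-! ## The algebra of internal subsets of the hyperfinite cycle -/

theorem IsCodeOf.below {a : M} {A : Set (Cycle k)} (h : IsCodeOf k a A) :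
    starRel₂ Below a k.val := by
  refine star_below k.isHypernat h.1 fun x hx => ?_
  rw [h.2] at hx
  obtain ⟨y, -, rfl⟩ := hx
  exact ⟨y.isHypernat, y.lt⟩

theorem IsCodeOf.val_mem {a : M} {A : Set (Cycle k)} (h : IsCodeOf k a A) (x : Cycle k) :
    x.val ∈ ext a ↔ x ∈ A := by
  rw [h.2, (val_injective k).mem_set_image]

theorem IsCodeOf.inter {a b : M} {A B : Set (Cycle k)} (ha : IsCodeOf k a A)
    (hb : IsCodeOf k b B) : IsCodeOf k (starFun₂ Obj.inter a b) (A ∩ B) :=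
  ⟨ha.1.inter b, by rw [ext_inter, ha.2, hb.2, Set.image_inter (val_injective k)]⟩

theorem IsCodeOf.diff {a b : M} {A B : Set (Cycle k)} (ha : IsCodeOf k a A)
    (hb : IsCodeOf k b B) : IsCodeOf k (starFun₂ Obj.diff a b) (A \ B) :=
  ⟨ha.1.diff b, by rw [ext_diff, ha.2, hb.2, Set.image_sdiff (val_injective k)]⟩

variable (k) in
theorem isCodeOf_univ : IsCodeOf k (starFun₁ initialSegment k.val) Set.univ := by
  refine ⟨isInternalCode_initialSegment k.val, ?_⟩
  rw [ext_initialSegment]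
  ext x
  constructor
  · exact fun h => ⟨⟨x, h.1, h.2⟩, trivial, rfl⟩
  · rintro ⟨y, -, rfl⟩
    exact ⟨y.isHypernat, y.lt⟩

theorem IsCodeOf.rotationPreimage {a : M} {A : Set (Cycle k)} (h : IsCodeOf k a A) :
    IsCodeOf k (starFun₂ rotationPreimage a k.val) (rotation k ⁻¹' A) := by
  have hrot : ∀ y : Cycle k,
      y.val ∈ ext (starFun₂ NSA.rotationPreimage a k.val) ↔ rotation k y ∈ A := by
    intro y
    rw [mem_ext_rotationPreimage, ← h.val_mem]
    by_cases hy : HLt y.val (starFun₂ Obj.sub k.val (star (Obj.real 1)))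
    · simp [rotation, hy, y.isHypernat, y.lt]
    · simp [rotation, hy, y.isHypernat, y.lt]
  refine ⟨isInternalCode_rotationPreimage a k.val, ?_⟩
  ext x
  constructor
  · intro hx
    have h1 := (mem_ext_rotationPreimage a k.val x).1 hx
    exact ⟨⟨x, h1.1, h1.2.1⟩, (hrot ⟨x, h1.1, h1.2.1⟩).1 hx, rfl⟩
  · rintro ⟨y, hy, rfl⟩
    exact (hrot y).2 hy

theorem inter_mem_internalSets {A B : Set (Cycle k)} (hA : A ∈ internalSets k)
    (hB : B ∈ internalSets k) : A ∩ B ∈ internalSets k := by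
  obtain ⟨a, ha⟩ := hA
  obtain ⟨b, hb⟩ := hB
  exact ⟨_, ha.inter hb⟩

theorem diff_mem_internalSets {A B : Set (Cycle k)} (hA : A ∈ internalSets k)
    (hB : B ∈ internalSets k) : A \ B ∈ internalSets k := by
  obtain ⟨a, ha⟩ := hA
  obtain ⟨b, hb⟩ := hB
  exact ⟨_, ha.diff hb⟩

variable (k) in
theorem univ_mem_internalSets : Set.univ ∈ internalSets k := ⟨_, isCodeOf_univ k⟩

variable (k) in
theorem empty_mem_internalSets : ∅ ∈ internalSets k := by
  simpa using diff_mem_internalSets (univ_mem_internalSets k) (univ_mem_internalSets k)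

theorem union_mem_internalSets {A B : Set (Cycle k)} (hA : A ∈ internalSets k)
    (hB : B ∈ internalSets k) : A ∪ B ∈ internalSets k := by
  have h := diff_mem_internalSets (univ_mem_internalSets k) (inter_mem_internalSets
    (diff_mem_internalSets (univ_mem_internalSets k) hA)
    (diff_mem_internalSets (univ_mem_internalSets k) hB))
  have h1 : Set.univ \ (Set.univ \ A ∩ (Set.univ \ B)) = A ∪ B := by
    ext x
    simp only [Set.mem_sdiff, Set.mem_univ, true_and, Set.mem_inter_iff, Set.mem_union]
    tauto
  rwa [h1] at h

theorem biUnion_mem_internalSets {A : ℕ → Set (Cycle k)} (hA : ∀ n, A n ∈ internalSets k)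
    (s : Finset ℕ) : ⋃ n ∈ s, A n ∈ internalSets k := by
  induction s using Finset.induction_on with
  | empty => simpa using empty_mem_internalSets k
  | insert n s _ ih =>
    rw [Finset.set_biUnion_insert]
    exact union_mem_internalSets (hA n) ih

/-- A countable cover of an internal set by internal sets has a finite subcover. -/
theorem exists_finset_cover (hM : IsAlephOneSaturated M) {A : Set (Cycle k)}
    (hA : A ∈ internalSets k) {B : ℕ → Set (Cycle k)} (hB : ∀ n, B n ∈ internalSets k)
    (h : A ⊆ ⋃ n, B n) : ∃ s : Finset ℕ, A ⊆ ⋃ n ∈ s, B n := by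
  by_contra! hne
  -- If no finite subfamily covers, the internal sets `A \ B n` have the finite intersection
  -- property; a common point, given by saturation, is uncovered.
  have hfin : ∀ s : Finset ℕ, (⋂ n ∈ s, val '' (A \ B n)).Nonempty := by
    intro s
    obtain ⟨x, hx, hxs⟩ := Set.not_subset.1 (hne s)
    refine ⟨x.val, Set.mem_iInter₂.2 fun n hn => ⟨x, ⟨hx, fun hxn => hxs ?_⟩, rfl⟩⟩
    exact Set.mem_biUnion hn hxn
  obtain ⟨y, hy⟩ := hM (fun n => val '' (A \ B n)) (fun n => diff_mem_internalSets hA (hB n)) hfin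
  rw [Set.mem_iInter] at hy
  obtain ⟨x, hx, rfl⟩ := hy 0
  obtain ⟨n, hn⟩ := Set.mem_iUnion.1 (h hx.1)
  exact ((val_injective k).mem_set_image.1 (hy n)).2 hn

/-! ## The normalised counting measure -/

theorem IsCodeOf.st_count_le {a b : M} {A B : Set (Cycle k)} (ha : IsCodeOf k a A)
    (hb : IsCodeOf k b B) (h : A ⊆ B) : st (count k a) ≤ st (count k b) :=
  st_mono (card_bounds ha.below).1
    (card_div_mono ha.below hb.below (by rw [ha.2, hb.2]; exact Set.image_mono h))
    (card_bounds hb.below).2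

/-- Monotonicity applied to `A ⊆ A` shows that all codes of `A` give the same value. -/
theorem IsCodeOf.stdCount_eq {a : M} {A : Set (Cycle k)} (ha : IsCodeOf k a A) :
    stdCount k A = ENNReal.ofReal (st (count k a)) :=
  le_antisymm (iInf₂_le (f := fun b _ => ENNReal.ofReal (st (count k b))) a ha)
    (le_iInf₂ fun _ hb => ENNReal.ofReal_le_ofReal (ha.st_count_le hb subset_rfl))

/-- `B` may be external: its value is then an infimum over no codes, that is `∞`. -/
theorem stdCount_mono {A B : Set (Cycle k)} (hA : A ∈ internalSets k) (h : A ⊆ B) :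
    stdCount k A ≤ stdCount k B := by
  obtain ⟨a, ha⟩ := hA
  rw [ha.stdCount_eq]
  exact le_iInf₂ fun _ hb => ENNReal.ofReal_le_ofReal (ha.st_count_le hb h)

theorem stdCount_le_inter_add_diff {A B : Set (Cycle k)} (hA : A ∈ internalSets k)
    (hB : B ∈ internalSets k) : stdCount k A ≤ stdCount k (A ∩ B) + stdCount k (A \ B) := by
  obtain ⟨a, ha⟩ := hA
  obtain ⟨b, hb⟩ := hB
  have bi := card_bounds (ha.inter hb).below
  have bd := card_bounds (ha.diff hb).below
  rw [ha.stdCount_eq, (ha.inter hb).stdCount_eq, (ha.diff hb).stdCount_eq,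
    count, count, count, ← ENNReal.ofReal_add (st_nonneg bi.1 bi.2) (st_nonneg bd.1 bd.2)]
  refine ENNReal.ofReal_le_ofReal ?_
  have h := st_add_le_st_add_st bi.1 bi.2 bd.1 bd.2
  rwa [card_split ha.below] at h

theorem stdCount_union_le {A B : Set (Cycle k)} (hA : A ∈ internalSets k)
    (hB : B ∈ internalSets k) : stdCount k (A ∪ B) ≤ stdCount k A + stdCount k B := by
  refine (stdCount_le_inter_add_diff (union_mem_internalSets hA hB) hA).trans ?_
  rw [Set.union_inter_cancel_left, Set.union_sdiff_left]
  exact add_le_add le_rfl (stdCount_mono (diff_mem_internalSets hB hA) Set.sdiff_subset)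

variable (k) in
theorem stdCount_empty : stdCount k ∅ = 0 := by
  obtain ⟨a, ha⟩ := empty_mem_internalSets k
  have bi := card_bounds (ha.inter ha).below
  have bd := card_bounds (ha.diff ha).below
  -- Splitting `∅` into `∅ ∩ ∅` and `∅ \ ∅` gives `2c ≤ c` for its standard count `c`.
  have h := st_add_le bi.1 bd.1 (by rw [card_split ha.below]; exact (card_bounds ha.below).2)
  rw [card_split ha.below] at h
  have h1 := (ha.st_count_le (ha.inter ha) (Set.empty_subset _))
  have h2 := (ha.st_count_le (ha.diff ha) (Set.empty_subset _))
  rw [ha.stdCount_eq, ENNReal.ofReal_eq_zero]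
  simp only [count] at h1 h2 ⊢
  linarith

theorem stdCount_biUnion_le {A : ℕ → Set (Cycle k)} (hA : ∀ n, A n ∈ internalSets k)
    (s : Finset ℕ) : stdCount k (⋃ n ∈ s, A n) ≤ ∑ n ∈ s, stdCount k (A n) := by
  induction s using Finset.induction_on with
  | empty => simp [stdCount_empty]
  | insert n s hn ih =>
    rw [Finset.set_biUnion_insert, Finset.sum_insert hn]
    exact (stdCount_union_le (hA n) (biUnion_mem_internalSets hA s)).trans (by gcongr)

theorem stdCount_of_notMem {A : Set (Cycle k)} (hA : A ∉ internalSets k) : stdCount k A = ∞ := by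
  simp only [stdCount, iInf_eq_top]
  exact fun a ha => absurd ⟨a, ha⟩ hA

/-! ## The Loeb measure -/

/-- A cover with an external member costs `∞`; any other cover has a finite subcover, to which
finite subadditivity applies. -/
theorem loebOuter_eq_stdCount (hM : IsAlephOneSaturated M) {A : Set (Cycle k)}
    (hA : A ∈ internalSets k) : loebOuter k A = stdCount k A := by
  refine le_antisymm (OuterMeasure.boundedBy_le A) ?_
  rw [loebOuter, OuterMeasure.boundedBy_eq_ofFunction (stdCount_empty k),
    OuterMeasure.ofFunction_apply]
  refine le_iInf₂ fun B hAB => ?_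
  by_cases hB : ∀ n, B n ∈ internalSets k
  · obtain ⟨s, hs⟩ := exists_finset_cover hM hA hB hAB
    calc stdCount k A ≤ stdCount k (⋃ n ∈ s, B n) := stdCount_mono hA hs
      _ ≤ ∑ n ∈ s, stdCount k (B n) := stdCount_biUnion_le hB s
      _ ≤ ∑' n, stdCount k (B n) := ENNReal.sum_le_tsum s
  · push Not at hB
    obtain ⟨n, hn⟩ := hB
    rw [ENNReal.tsum_eq_top_of_eq_top ⟨n, stdCount_of_notMem hn⟩]
    exact le_top

theorem measurableSet_of_mem_internalSets {A : Set (Cycle k)} (hA : A ∈ internalSets k) :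
    MeasurableSet A :=
  MeasurableSpace.measurableSet_generateFrom hA

theorem loeb_eq_stdCount (hM : IsAlephOneSaturated M) {A : Set (Cycle k)}
    (hA : A ∈ internalSets k) : loeb k A = stdCount k A := by
  rw [loeb, toMeasure_apply _ _ (measurableSet_of_mem_internalSets hA),
    loebOuter_eq_stdCount hM hA]

theorem isProbabilityMeasure_loeb (hM : IsAlephOneSaturated M) (hk : k.IsInfinite) :
    IsProbabilityMeasure (loeb k) := by
  have h0 : HLt (star (Obj.real 0)) k.val := by simpa using hk 0
  refine ⟨?_⟩
  rw [loeb_eq_stdCount hM (univ_mem_internalSets k), (isCodeOf_univ k).stdCount_eq, count,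
    card_initialSegment_div k.isHypernat h0, st_star, ENNReal.ofReal_one]

theorem rotation_preimage_mem_internalSets {A : Set (Cycle k)} (hA : A ∈ internalSets k) :
    rotation k ⁻¹' A ∈ internalSets k := by
  obtain ⟨a, ha⟩ := hA
  exact ⟨_, ha.rotationPreimage⟩

theorem stdCount_rotation_preimage {A : Set (Cycle k)} (hA : A ∈ internalSets k) :
    stdCount k (rotation k ⁻¹' A) = stdCount k A := by
  obtain ⟨a, ha⟩ := hA
  rw [ha.stdCount_eq, ha.rotationPreimage.stdCount_eq, count, count,
    starFun_card_rotationPreimage ha.below]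

variable (k) in
theorem measurable_rotation : Measurable (rotation k) :=
  measurable_generateFrom fun _ hA =>
    measurableSet_of_mem_internalSets (rotation_preimage_mem_internalSets hA)

theorem measurePreserving_rotation (hM : IsAlephOneSaturated M) (hk : k.IsInfinite) :
    MeasurePreserving (rotation k) (loeb k) (loeb k) := by
  have := isProbabilityMeasure_loeb hM hk
  have hmap : ∀ A ∈ internalSets k, (loeb k).map (rotation k) A = loeb k A := by
    intro A hA
    rw [Measure.map_apply (measurable_rotation k) (measurableSet_of_mem_internalSets hA),
      loeb_eq_stdCount hM (rotation_preimage_mem_internalSets hA), loeb_eq_stdCount hM hA,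
      stdCount_rotation_preimage hA]
  refine ⟨measurable_rotation k, ?_⟩
  have := Measure.isFiniteMeasure_map (loeb k) (rotation k)
  exact ext_of_generate_finite _ rfl (fun A hA B hB _ => inter_mem_internalSets hA hB) hmap
    (hmap _ (univ_mem_internalSets k))

theorem isProbabilityMeasure_loebMeasure (hM : IsAlephOneSaturated M) (hk : k.IsInfinite) :
    IsProbabilityMeasure (loebMeasure k) :=
  ⟨(isProbabilityMeasure_loeb hM hk).measure_univ⟩

/-- Measurable sets of the completion are the null measurable sets, and a measure preserving map
pulls these back with their measure. -/
theorem measurePreserving_loebRotation (hM : IsAlephOneSaturated M) (hk : k.IsInfinite) :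
    MeasurePreserving (loebRotation k) (loebMeasure k) (loebMeasure k) := by
  have hr := measurePreserving_rotation hM hk
  have hm : Measurable (loebRotation k) := fun s hs =>
    NullMeasurableSet.preimage (s := s) hs hr.quasiMeasurePreserving
  refine ⟨hm, Measure.ext fun s hs => ?_⟩
  rw [Measure.map_apply hm hs]
  exact hr.measure_preimage (s := s) hs

end NSA.Cycle

/-! ### The ergodic theorem for the hyperfinite cycle. -/

theorem mainTheorem2 {M : Type*} [NSA.NonstandardModel M] (hM : NSA.IsAlephOneSaturated M)
    (k : NSA.Hypernat M) (hk : k.IsInfinite) :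
    IsProbabilityMeasure (NSA.Cycle.loebMeasure k) ∧
    (∀ (a : M) (A : Set (NSA.Cycle k)), NSA.Cycle.IsCodeOf k a A →
      NSA.Cycle.loebMeasure k A = ENNReal.ofReal (NSA.st (NSA.Cycle.count k a))) ∧
    MeasurePreserving (NSA.Cycle.loebRotation k)
      (NSA.Cycle.loebMeasure k) (NSA.Cycle.loebMeasure k) ∧
    ∀ g : NSA.Cycle.LoebSpace k → ℝ, Integrable g (NSA.Cycle.loebMeasure k) →
      ∃ g' : NSA.Cycle.LoebSpace k → ℝ,
        (∀ᵐ x ∂(NSA.Cycle.loebMeasure k),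
          Tendsto (fun n : ℕ => birkhoffAverage ℝ (NSA.Cycle.loebRotation k) g n x)
            atTop (𝓝 (g' x))) ∧
        Integrable g' (NSA.Cycle.loebMeasure k) ∧
        ∫ x, g' x ∂(NSA.Cycle.loebMeasure k) = ∫ x, g x ∂(NSA.Cycle.loebMeasure k) := by
  have := NSA.Cycle.isProbabilityMeasure_loebMeasure hM hk
  have hr := NSA.Cycle.measurePreserving_loebRotation hM hk
  refine ⟨this, fun a A ha => ?_, hr, fun g hg => ?_⟩
  -- Completion enlarges the σ-algebra but keeps the value on every set.
  · exact (NSA.Cycle.loeb_eq_stdCount hM ⟨a, ha⟩).trans ha.stdCount_eq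
  · exact ⟨_, ae_tendsto_birkhoffAverage_condExp hr hg, integrable_condExp,
      integral_condExp (MeasurableSpace.invariants_le _)⟩
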